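/- Let $n,m,s$ be nonnegative integers with $m\le s\le n$, and let $A\in\mathbb{R}^{n\times m}$ have full column rank. Let $A=U\Sigma V^\top$ be a real singular-value decomposition, with $U\in\mathbb{R}^{n\times m}$, $U^\top U=I_m$, $V\in\mathbb{R}^{m\times m}$ orthogonal and $\Sigma\in\mathbb{R}^{m\times m}$ diagonal with nonnegative diagonal entries, and let $W\in\mathbb{R}^{n\times(n-m)}$ satisfy $I_n-UU^\top=WW^\top$. Write $\mathbf e$ for the all-ones vector, and $\operatorname{ldet}$ for the logarithm of the determinant, with $\log 0=-\infty$. For $\lambda\in\mathbb{R}^k_+$ with $\lambda_1\ge\dots\ge\lambda_k$ and an integer $0<t\le k$, let $\iota$ be the unique integer with $0\le\iota<t$ and $\lambda_\iota>\frac1{t-\iota}\sum_{\ell=\iota+1}^k\lambda_\ell\ge\lambda_{\iota+1}$ (with $\lambda_0=+\infty$), and put $$\phi_t(\lambda)=\sum_{\ell=1}^{\iota}\log\lambda_\ell+(t-\iota)\log\Big(\tfrac1{t-\iota}\sum_{\ell=\iota+1}^k\lambda_\ell\Big)\in\mathbb{R}\cup\{-\infty\};$$ put $\phi_0=0$. For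 a symmetric positive-semidefinite $X$ of order $k$, let $\Gamma_t(X)=\phi_t(\lambda(X))$, where $\lambda(X)$ is the vector of eigenvalues of $X$ in nonincreasing order. Consider the 0/1 D-optimality problem $$\max\{\operatorname{ldet}(A^\top\operatorname{Diag}(x)A):\ \mathbf e^\top x=s,\ x\in\{0,1\}^n\}\tag{D-Opt(0/1)}$$ and the $\Gamma$-bound problem $$z_\Gamma=\max\Big\{2\sum_{i=1}^m\log\Sigma_{ii}+\Gamma_{n-s}(W^\top\operatorname{Diag}(y)W):\ \mathbf e^\top y=n-s,\ 0\le y\le\mathbf e\Big\}.\tag{$\Gamma$}$$ Then $(\Gamma)$ is an exact convex relaxation of D-Opt(0/1), under the substitution $y=\mathbf e-x$. That is: 1. for every feasible $x$ of D-Opt(0/1), the point $\mathbf e-x$ is feasible for $(\Gamma)$, and $$2\sum_{i=1}^m\log\Sigma_{ii}+\Gamma_{n-s}(W^\top\operatorname{Diag}(\mathbf e-x)W)=\operatorname{ldet}(A^\top\operatorname{Diag}(x)A);$$ 2. for every feasible $y\in\{0,1\}^n$ of $(\Gamma)$, the point $\mathbf e-y$ is feasible for D-Opt(0/1); 3. $(\Gamma)$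 is a concave maximization problem: its feasible set is convex and its objective function, with values in $\mathbb{R}\cup\{-\infty\}$, is concave on it; 4. the maximum in $(\Gamma)$ is attained (possibly with value $-\infty$); 5. the optimal value of D-Opt(0/1) is at most $z_\Gamma$. -/

import Mathlib

open Matrix

noncomputable section

namespace DOpt

/-- The extended logarithm of a nonnegative real number, with `log 0 = -∞`. -/
def elog (a : ℝ) : EReal := ENNReal.log (ENNReal.ofReal a)

/-- The log-determinant of a matrix with nonnegative determinant; it is `-∞` on
singular matrices. -/
def ldet {k : ℕ} (X : Matrix (Fin k) (Fin k) ℝ) : EReal := elog X.det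

/-- The sum `∑_{ℓ = j+1}^{k} lam_ℓ` (one-based indices), that is, the sum of
the entries whose zero-based index is at least `j`. -/
def tailSum {k : ℕ} (lam : Fin k → ℝ) (j : ℕ) : ℝ :=
  ∑ i with j ≤ i.val, lam i

/-- `j` satisfies `0 ≤ j < t` and (one-based, with `lam_0 = +∞`)
`lam_j > (1 / (t - j)) * ∑_{ℓ = j+1}^{k} lam_ℓ ≥ lam_{j+1}`. -/
def IsIota {k : ℕ} (t : ℕ) (lam : Fin k → ℝ) (j : ℕ) : Prop :=
  j < t ∧
  (∀ i : Fin k, i.val + 1 = j → tailSum lam j / ((t : ℝ) - (j : ℝ)) < lam i) ∧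
  (∀ i : Fin k, i.val = j → lam i ≤ tailSum lam j / ((t : ℝ) - (j : ℝ)))

/-- The integer `iota` of `lam` with respect to `t`; see `existsUnique_isIota`. -/
def iota {k : ℕ} (t : ℕ) (lam : Fin k → ℝ) : ℕ := sInf {j | IsIota t lam j}

lemma tailSum_succ {k : ℕ} (lam : Fin k → ℝ) (j : ℕ) (hj : j < k) :
    tailSum lam j = lam ⟨j, hj⟩ + tailSum lam (j + 1) := by
  unfold tailSum
  have h : (Finset.univ.filter fun i : Fin k => j ≤ i.val)
      = insert ⟨j, hj⟩ (Finset.univ.filter fun i : Fin k => j + 1 ≤ i.val) := by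
    ext i
    simp only [Finset.mem_filter, Finset.mem_univ, true_and, Finset.mem_insert, Fin.ext_iff]
    omega
  rw [h, Finset.sum_insert (by simp)]

/-- For a nonincreasing nonnegative vector and `0 < t ≤ k`, the integer `iota` is well defined. -/
theorem existsUnique_isIota {k : ℕ} (t : ℕ) (ht : 0 < t) (htk : t ≤ k) (lam : Fin k → ℝ)
    (hanti : Antitone lam) (hnn : ∀ i, 0 ≤ lam i) : ∃! j, IsIota t lam j := by
  classical
  let Q : ℕ → Prop := fun j => ∀ h : j < k, ((t : ℝ) - (j : ℝ)) * lam ⟨j, h⟩ ≤ tailSum lam j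
  have hiff : ∀ j, IsIota t lam j ↔ j < t ∧ (∀ i, i + 1 = j → ¬ Q i) ∧ Q j := by
    intro j
    unfold IsIota
    refine and_congr_right fun hjt => ?_
    have hpos : (0 : ℝ) < (t : ℝ) - (j : ℝ) := sub_pos.2 (by exact_mod_cast hjt)
    refine and_congr ?_ ?_
    · constructor
      · rintro h i rfl hQ
        have hi : i < k := by omega
        have h1 := h ⟨i, hi⟩ rfl
        have h2 := hQ hi
        rw [tailSum_succ lam i hi] at h2
        rw [div_lt_iff₀ hpos] at h1
        push_cast at h1
        nlinarith
      · rintro h ⟨i, hi⟩ hij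
        have hij' : i + 1 = j := hij
        subst hij'
        have h1 := h i rfl
        simp only [Q, not_forall, not_le] at h1
        obtain ⟨_, h1⟩ := h1
        rw [tailSum_succ lam i hi] at h1
        rw [div_lt_iff₀ hpos]
        push_cast
        nlinarith
    · constructor
      · intro h hj
        have h1 := h ⟨j, hj⟩ rfl
        rw [le_div_iff₀ hpos] at h1
        linarith
      · rintro h ⟨i, hi⟩ hij
        have hij' : i = j := hij
        subst hij'
        rw [le_div_iff₀ hpos]
        have := h hi
        linarith
  have hstep : ∀ j, j + 1 < t → Q j → Q (j + 1) := by
    intro j hj hQ hk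
    have hjk : j < k := by omega
    have h1 := hQ hjk
    rw [tailSum_succ lam j hjk] at h1
    have h2 : lam ⟨j + 1, hk⟩ ≤ lam ⟨j, hjk⟩ := hanti (by simp)
    have h3 : (0 : ℝ) ≤ (t : ℝ) - ((j + 1 : ℕ) : ℝ) := sub_nonneg.2 (by exact_mod_cast hj.le)
    have h4 := mul_le_mul_of_nonneg_left h2 h3
    push_cast at h4 ⊢
    nlinarith
  have hmono : ∀ d j, j + d < t → Q j → Q (j + d) := by
    intro d
    induction d with
    | zero => intro j _ h; simpa using h
    | succ d ih =>
      intro j hj h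
      exact hstep (j + d) (by omega) (ih j (by omega) h)
  have hlast : Q (t - 1) := by
    intro h
    rw [tailSum_succ lam (t - 1) h]
    have h1 : ((t - 1 : ℕ) : ℝ) = (t : ℝ) - 1 := by
      rw [Nat.cast_sub (by omega)]; simp
    have h2 : 0 ≤ tailSum lam (t - 1 + 1) := Finset.sum_nonneg fun i _ => hnn i
    rw [h1]
    linarith
  have hex : ∃ j, Q j := ⟨t - 1, hlast⟩
  refine ⟨Nat.find hex, ?_, ?_⟩
  · change IsIota t lam (Nat.find hex)
    rw [hiff]
    have hle := Nat.find_min' hex hlast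
    exact ⟨by omega, fun i hi => Nat.find_min hex (by omega), Nat.find_spec hex⟩
  · intro j hj
    rw [hiff] at hj
    obtain ⟨hjt, hprev, hQ⟩ := hj
    have hle := Nat.find_min' hex hQ
    by_contra hne
    have hQ' := hmono (j - 1 - Nat.find hex) (Nat.find hex) (by omega) (Nat.find_spec hex)
    have he : Nat.find hex + (j - 1 - Nat.find hex) = j - 1 := by omega
    rw [he] at hQ'
    exact hprev (j - 1) (by omega) hQ'

/-- `phi_t(lam) = ∑_{ℓ=1}^{iota} log lam_ℓ + (t - iota) log ((1/(t - iota)) ∑_{ℓ > iota} lam_ℓ)`,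
for a nonincreasing nonnegative vector `lam` and `0 < t ≤ k`. For `t = 0` the value is `0`
(an empty sum). -/
def phi {k : ℕ} (t : ℕ) (lam : Fin k → ℝ) : EReal :=
  if t = 0 then 0
  else
    (∑ i with i.val < iota t lam, elog (lam i))
      + ((t - iota t lam : ℕ) : EReal)
        * elog (tailSum lam (iota t lam) / ((t : ℝ) - (iota t lam : ℝ)))

/-- The function `Gamma_t(X) = phi_t(lambda(X))`, where `lambda(X)` lists the eigenvalues of the
symmetric matrix `X` in nonincreasing order with multiplicity. It is only used on
positive-semidefinite matrices. -/
def Gamma {k : ℕ} (t : ℕ) (X : Matrix (Fin k) (Fin k) ℝ) : EReal :=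
  open scoped Classical in
  if hX : X.IsHermitian then phi t hX.eigenvalues₀ else ⊥

/-- `A = U * S * Vᵀ` is a (thin) real singular-value decomposition of `A`. -/
structure IsSVD {n m : ℕ} (A U : Matrix (Fin n) (Fin m) ℝ) (S V : Matrix (Fin m) (Fin m) ℝ) :
    Prop where
  eq : A = U * S * Vᵀ
  orthU : Uᵀ * U = 1
  orthV : Vᵀ * V = 1
  diag : S.IsDiag
  nonneg : ∀ i, 0 ≤ S i i

/-- The feasible set `{x ∈ {0,1}ⁿ : eᵀ x = s}` of the 0/1 D-optimality problem. -/
def dOptFeasible (n s : ℕ) : Set (Fin n → ℝ) :=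
  {x | (∀ i, x i = 0 ∨ x i = 1) ∧ ∑ i, x i = (s : ℝ)}

/-- The objective function `ldet (Aᵀ Diag(x) A)` of the 0/1 D-optimality problem. -/
def dOptObjective {n m : ℕ} (A : Matrix (Fin n) (Fin m) ℝ) (x : Fin n → ℝ) : EReal :=
  ldet (Aᵀ * diagonal x * A)

/-- The optimal value of the 0/1 D-optimality problem. -/
def dOptValue {n m : ℕ} (s : ℕ) (A : Matrix (Fin n) (Fin m) ℝ) : EReal :=
  ⨆ x ∈ dOptFeasible n s, dOptObjective A x

/-- The feasible set `{y ∈ ℝⁿ : eᵀ y = n - s, 0 ≤ y ≤ e}` of the problem defining the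
Gamma-bound. -/
def gammaFeasible (n s : ℕ) : Set (Fin n → ℝ) :=
  {y | ∑ i, y i = (n : ℝ) - (s : ℝ) ∧ ∀ i, 0 ≤ y i ∧ y i ≤ 1}

/-- The objective function `2 ∑ log S_ii + Gamma_{n-s} (Wᵀ Diag(y) W)` of the problem defining
the Gamma-bound. -/
def gammaObjective {n m k : ℕ} (s : ℕ) (S : Matrix (Fin m) (Fin m) ℝ)
    (W : Matrix (Fin n) (Fin k) ℝ) (y : Fin n → ℝ) : EReal :=
  ((2 * ∑ i, Real.log (S i i) : ℝ) : EReal) + Gamma (n - s) (Wᵀ * diagonal y * W)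

/-- The Gamma-bound, that is, the optimal value of the problem that defines it. -/
def gammaBound {n m k : ℕ} (s : ℕ) (S : Matrix (Fin m) (Fin m) ℝ)
    (W : Matrix (Fin n) (Fin k) ℝ) : EReal :=
  ⨆ y ∈ gammaFeasible n s, gammaObjective s S W y

/-- Concavity of a function with values in `ℝ ∪ {-∞}` on a convex set. (In `EReal` one has
`0 * (-∞) = 0`, so the trivial cases `a = 0` and `b = 0` are consistent.) -/
def EConcaveOn {E : Type*} [AddCommGroup E] [Module ℝ E] (C : Set E) (f : E → EReal) : Prop :=
  Convex ℝ C ∧ (∀ y ∈ C, f y ≠ ⊤) ∧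
    ∀ y ∈ C, ∀ z ∈ C, ∀ a b : ℝ, 0 ≤ a → 0 ≤ b → a + b = 1 →
      (a : EReal) * f y + (b : EReal) * f z ≤ f (a • y + b • z)

end DOpt

end

namespace DOpt

/-! ### The extended logarithm -/

/-! Exactness is a determinant identity. For a 0/1 vector `x` with sum `s`, let `M` consist of the
`n - s` rows of `W` with `x i = 0`. The matrix in the relaxation is `Mᵀ * M`, which has at most `n -
s` nonzero eigenvalues. In that case `phi` reduces to the sum of the logarithms of the leading
eigenvalues, so `Gamma` equals the log-determinant of `M * Mᵀ` (`Gamma_transpose_mul_self`). Writing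
`B` for the same rows of `U`, one has `M * Mᵀ = 1 - B * Bᵀ`, and `det (1 - B * Bᵀ) = det (1 - Bᵀ *
B) = det (Uᵀ * diagonal x * U)` because `Uᵀ * U = 1`. The singular values account for the remaining
factor `det S ^ 2`.

Concavity and attainment both come from one fact: on the positive-semidefinite cone, `Gamma t` is an
infimum of affine functions (`isInfAffineOn_Gamma`). An orthogonal `Q` and positive weights `g`,
constant off a set `S` and no smaller on `S`, give the majorant `∑ (Qᵀ * Y * Q) i i / g i` plus a
constant. Taking for `Q` an eigenbasis of `X` and for `g` its leading eigenvalues and tail average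
makes it tight at `X`; if the tail average is zero, a tail weight tending to zero drives the value
to `-∞`. That it is a majorant (`phi_le_of_doublyStochastic`) follows from `log u ≤ u - 1`, averaged
with the doubly stochastic matrix of squared entries of the change of eigenbasis. Such an infimum is
concave and upper semicontinuous, and the feasible set is compact. -/

lemma elog_of_pos {a : ℝ} (ha : 0 < a) : elog a = (Real.log a : EReal) :=
  ENNReal.log_ofReal_of_pos ha

lemma elog_zero : elog 0 = ⊥ := by simp [elog]

lemma elog_one : elog 1 = 0 := by simp [elog]

lemma elog_mul {a : ℝ} (ha : 0 ≤ a) (b : ℝ) : elog (a * b) = elog a + elog b := by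
  simp only [elog]
  rw [ENNReal.ofReal_mul ha, ENNReal.log_mul_add]

lemma elog_prod {ι : Type*} (s : Finset ι) (f : ι → ℝ) (hf : ∀ i, 0 ≤ f i) :
    elog (∏ i ∈ s, f i) = ∑ i ∈ s, elog (f i) := by
  classical
  induction s using Finset.induction_on with
  | empty => simp [elog_one]
  | insert a s ha ih => rw [Finset.prod_insert ha, Finset.sum_insert ha, elog_mul (hf a), ih]

lemma coe_finset_sum {ι : Type*} (s : Finset ι) (f : ι → ℝ) :
    ((∑ i ∈ s, f i : ℝ) : EReal) = ∑ i ∈ s, (f i : EReal) := by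
  classical
  induction s using Finset.induction_on with
  | empty => simp
  | insert a s ha ih => rw [Finset.sum_insert ha, Finset.sum_insert ha, EReal.coe_add, ih]

/-! ### The spectral function `phi` -/

lemma card_filter_val_lt {k j : ℕ} (hj : j ≤ k) :
    (Finset.univ.filter fun i : Fin k => i.val < j).card = j := by
  rw [Fin.card_filter_val_lt, min_eq_right hj]

lemma card_filter_le_val_lt {k j t : ℕ} (hjt : j ≤ t) (htk : t ≤ k) :
    (Finset.univ.filter fun i : Fin k => j ≤ i.val ∧ i.val < t).card = t - j := by
  have h := Finset.card_filter_add_card_filter_not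
    (s := Finset.univ.filter fun i : Fin k => i.val < t) (fun i => i.val < j)
  rw [Finset.filter_filter, Finset.filter_filter, card_filter_val_lt htk] at h
  have h1 : (Finset.univ.filter fun i : Fin k => i.val < t ∧ i.val < j)
      = Finset.univ.filter fun i : Fin k => i.val < j := by
    ext i; simp; omega
  have h2 : (Finset.univ.filter fun i : Fin k => i.val < t ∧ ¬ i.val < j)
      = Finset.univ.filter fun i : Fin k => j ≤ i.val ∧ i.val < t := by
    ext i; simp; omega
  rw [h1, h2, card_filter_val_lt (hjt.trans htk)] at h
  omega

/-- `j` and `mu` are the number of separate logarithms and the average of the remaining entries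
in `phi t lam`. -/
structure IsSplit {k : ℕ} (t : ℕ) (lam : Fin k → ℝ) (j : ℕ) (mu : ℝ) : Prop where
  lt : j < t
  nonneg : 0 ≤ mu
  head : ∀ i : Fin k, i.val < j → mu < lam i
  tail : ∀ i : Fin k, j ≤ i.val → lam i ≤ mu
  sum_tail : ∑ i with ¬ i.val < j, lam i = ((t : ℝ) - j) * mu
  phi_eq : phi t lam = (∑ i with i.val < j, elog (lam i)) + ((t - j : ℕ) : EReal) * elog mu

lemma exists_isSplit {k : ℕ} {t : ℕ} (ht : 0 < t) (htk : t ≤ k) {lam : Fin k → ℝ}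
    (hanti : Antitone lam) (hnn : ∀ i, 0 ≤ lam i) : ∃ j mu, IsSplit t lam j mu := by
  obtain ⟨j, hj, huniq⟩ := existsUnique_isIota t ht htk lam hanti hnn
  have hset : {j | IsIota t lam j} = {j} := by
    ext i
    exact ⟨fun h => huniq i h, fun h => by rw [Set.mem_singleton_iff.1 h]; exact hj⟩
  have hiota : iota t lam = j := by simp [iota, hset]
  obtain ⟨hjt, hhead, htail⟩ := hj
  have hpos : (0 : ℝ) < (t : ℝ) - j := sub_pos.2 (by exact_mod_cast hjt)
  refine ⟨j, tailSum lam j / ((t : ℝ) - j), hjt, ?_, ?_, ?_, ?_, ?_⟩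
  · exact div_nonneg (Finset.sum_nonneg fun i _ => hnn i) hpos.le
  · intro i hi
    -- `IsIota` compares the average only with the two entries adjacent to the cut; monotonicity
    -- extends this to all entries.
    have := hhead ⟨j - 1, by omega⟩ (by simp; omega)
    exact this.trans_le (hanti (by rw [Fin.le_def]; simp; omega))
  · intro i hi
    have := htail ⟨j, by omega⟩ rfl
    exact (hanti (by rw [Fin.le_def]; simpa using hi)).trans this
  · rw [mul_div_cancel₀ _ hpos.ne']
    simp [tailSum]
  · rw [phi, if_neg ht.ne', hiota]

namespace IsSplit

variable {k t j : ℕ} {lam : Fin k → ℝ} {mu : ℝ}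

lemma phi_eq_bot (h : IsSplit t lam j mu) (hmu : mu = 0) : phi t lam = ⊥ := by
  -- Strict positivity matters, since `0 * ⊥ = 0` in `EReal`.
  have hpos : (0 : ℝ) < ((t - j : ℕ) : ℝ) := by exact_mod_cast Nat.sub_pos_of_lt h.lt
  rw [h.phi_eq, hmu, elog_zero]
  have : ((t - j : ℕ) : EReal) * ⊥ = ⊥ := by
    have := EReal.coe_mul_bot_of_pos hpos
    simpa using this
  rw [this, EReal.add_bot]

lemma phi_eq_coe (h : IsSplit t lam j mu) (hmu : 0 < mu) :
    phi t lam = ((∑ i with i.val < j, Real.log (lam i) + ((t : ℝ) - j) * Real.log mu : ℝ) : EReal) := by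
  rw [h.phi_eq, elog_of_pos hmu, EReal.coe_add, coe_finset_sum, EReal.coe_mul,
    ← Nat.cast_sub h.lt.le]
  congr 1
  · refine Finset.sum_congr rfl fun i hi => ?_
    rw [elog_of_pos (hmu.trans (h.head i (Finset.mem_filter.1 hi).2))]

end IsSplit

/-- If at most `t` entries of `lam` are nonzero, then `phi t lam` is the sum of the logarithms of the
first `t` entries. -/
lemma phi_eq_sum_elog {k t : ℕ} (htk : t ≤ k) {lam : Fin k → ℝ}
    (hanti : Antitone lam) (hnn : ∀ i, 0 ≤ lam i) (hzero : ∀ i : Fin k, t ≤ i.val → lam i = 0) :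
    phi t lam = ∑ i with i.val < t, elog (lam i) := by
  rcases Nat.eq_zero_or_pos t with rfl | ht
  · simp [phi]
  obtain ⟨j, mu, h⟩ := exists_isSplit ht htk hanti hnn
  have hcard := card_filter_le_val_lt h.lt.le htk
  -- The `t - j` possibly nonzero tail entries sum to `(t - j) * mu` and none exceeds `mu`, so all
  -- of them equal `mu`.
  have hsum : ∑ i with j ≤ i.val ∧ i.val < t, lam i
      = ∑ i : Fin k with j ≤ i.val ∧ i.val < t, mu := by
    rw [Finset.sum_const, hcard, nsmul_eq_mul, Nat.cast_sub h.lt.le, ← h.sum_tail]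
    refine Finset.sum_subset ?_ ?_
    · intro i; simp; omega
    · intro i hi hi'
      simp only [Finset.mem_filter, Finset.mem_univ, true_and, not_lt] at hi hi'
      exact hzero i (by omega)
  have heq : ∀ i : Fin k, j ≤ i.val ∧ i.val < t → lam i = mu := by
    have := (Finset.sum_eq_sum_iff_of_le (s := Finset.univ.filter
      fun i : Fin k => j ≤ i.val ∧ i.val < t) (f := lam) (g := fun _ => mu)
      (fun i hi => h.tail i (Finset.mem_filter.1 hi).2.1)).1 hsum
    exact fun i hi => this i (by simpa using hi)
  rw [h.phi_eq]
  have hsplit := Finset.sum_filter_add_sum_filter_not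
    (Finset.univ.filter fun i : Fin k => i.val < t) (fun i => i.val < j) (fun i => elog (lam i))
  rw [← hsplit, Finset.filter_filter, Finset.filter_filter]
  congr 1
  · refine Finset.sum_congr ?_ fun _ _ => rfl
    ext i; simp; have := h.lt; omega
  · have h2 : (Finset.univ.filter fun i : Fin k => i.val < t ∧ ¬ i.val < j)
        = Finset.univ.filter fun i : Fin k => j ≤ i.val ∧ i.val < t := by
      ext i; simp; omega
    rw [h2, Finset.sum_congr rfl (fun i hi => by rw [heq i (Finset.mem_filter.1 hi).2]),
      Finset.sum_const, hcard, EReal.nsmul_eq_mul]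

/-- The excess `log (g i) - log mu` is nonnegative on `S` and zero elsewhere, so weights in `[0, 1]`
do best by being `1` on `S`; the fixed total weight turns the subtracted `log mu` into the constant.
-/
lemma sum_weight_log_le {ι : Type*} [Fintype ι] [DecidableEq ι] (S : Finset ι) {e g : ι → ℝ}
    {mu t : ℝ} (hmu : 0 < mu) (he : ∀ i, 0 ≤ e i ∧ e i ≤ 1) (hsum : ∑ i, e i = t)
    (hS : ∀ i ∈ S, mu ≤ g i) (hS' : ∀ i ∉ S, g i = mu) :
    ∑ i, e i * Real.log (g i) ≤ ∑ i ∈ S, Real.log (g i) + (t - S.card) * Real.log mu := by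
  have h1 : ∑ i, e i * (Real.log (g i) - Real.log mu)
      ≤ ∑ i ∈ S, (Real.log (g i) - Real.log mu) := by
    rw [← Finset.sum_subset (Finset.subset_univ S)
      (fun i _ hi => by rw [hS' i hi, sub_self, mul_zero])]
    refine Finset.sum_le_sum fun i hi => ?_
    have := Real.log_le_log hmu (hS i hi)
    nlinarith [he i]
  simp only [mul_sub, Finset.sum_sub_distrib, Finset.sum_const, nsmul_eq_mul] at h1
  rw [← Finset.sum_mul, hsum] at h1
  linarith

/-- The family of affine majorants of `phi t`, composed with a doubly stochastic matrix. -/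
lemma phi_le_of_doublyStochastic {k t : ℕ} (ht : 0 < t) (htk : t ≤ k) {lam : Fin k → ℝ}
    (hanti : Antitone lam) (hnn : ∀ i, 0 ≤ lam i) {ι : Type*} [Fintype ι] [DecidableEq ι]
    {D : ι → Fin k → ℝ} (hD : ∀ i l, 0 ≤ D i l) (hrow : ∀ i, ∑ l, D i l = 1)
    (hcol : ∀ l, ∑ i, D i l = 1) (S : Finset ι) {g : ι → ℝ} {mu : ℝ} (hmu : 0 < mu)
    (hS : ∀ i ∈ S, mu ≤ g i) (hS' : ∀ i ∉ S, g i = mu) :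
    phi t lam ≤ ((∑ i, (∑ l, D i l * lam l) / g i
      + (∑ i ∈ S, Real.log (g i) + ((t : ℝ) - S.card) * Real.log mu - t) : ℝ) : EReal) := by
  obtain ⟨j, nu, h⟩ := exists_isSplit ht htk hanti hnn
  rcases h.nonneg.eq_or_lt with hnu | hnu
  · rw [h.phi_eq_bot hnu.symm]; exact bot_le
  rw [h.phi_eq_coe hnu, EReal.coe_le_coe_iff]
  have hg : ∀ i, 0 < g i := fun i => by
    by_cases hi : i ∈ S
    · exact hmu.trans_le (hS i hi)
    · rw [hS' i hi]; exact hmu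
  -- The weights `c = lam / G` lie in `[0, 1]` and sum to `t`, and `phi t lam = ∑ c * log G`. Hence
  -- the averages of `c` under `D` are admissible in `sum_weight_log_le`.
  set G : Fin k → ℝ := fun l => if l.val < j then lam l else nu with hG
  have hGpos : ∀ l, 0 < G l := fun l => by
    simp only [hG]; split_ifs with hl
    · exact hnu.trans (h.head l hl)
    · exact hnu
  set c : Fin k → ℝ := fun l => lam l / G l with hc
  have hcG : ∀ l, c l * G l = lam l := fun l => div_mul_cancel₀ _ (hGpos l).ne'
  have hc0 : ∀ l, 0 ≤ c l := fun l => div_nonneg (hnn l) (hGpos l).le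
  have hc1 : ∀ l, c l ≤ 1 := fun l => by
    rw [hc, div_le_one (hGpos l)]
    simp only [hG]; split_ifs with hl
    · exact le_rfl
    · exact h.tail l (not_lt.1 hl)
  -- Used with `f = 1` for the total of `c`, and with `f = Real.log` for the value of `phi`.
  have hsplit : ∀ f : ℝ → ℝ, ∑ l, c l * f (G l)
      = ∑ l with l.val < j, f (lam l) + ((t : ℝ) - j) * f nu := by
    intro f
    rw [← Finset.sum_filter_add_sum_filter_not Finset.univ (fun l : Fin k => l.val < j)]
    congr 1
    · refine Finset.sum_congr rfl fun l hl => ?_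
      have hl := (Finset.mem_filter.1 hl).2
      have : G l = lam l := by simp [hG, hl]
      have h1 : c l = 1 := by
        simpa [this] using (mul_eq_right₀ (hGpos l).ne').1 ((hcG l).trans this.symm)
      rw [h1, this, one_mul]
    · have : ∀ l ∈ Finset.univ.filter (fun l : Fin k => ¬ l.val < j),
          c l * f (G l) = lam l * (f nu / nu) := fun l hl => by
        have hl := (Finset.mem_filter.1 hl).2
        simp only [hc, hG, if_neg hl]; ring
      rw [Finset.sum_congr rfl this, ← Finset.sum_mul, h.sum_tail]
      field_simp
  have hcsum : ∑ l, c l = t := by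
    have := hsplit fun _ => 1
    simp only [mul_one, Finset.sum_const, nsmul_eq_mul,
      card_filter_val_lt (h.lt.le.trans htk)] at this
    linarith
  have hweight := sum_weight_log_le S (e := fun i => ∑ l, D i l * c l) (g := g) (mu := mu)
    (t := (t : ℝ)) hmu
    (fun i => ⟨Finset.sum_nonneg fun l _ => mul_nonneg (hD i l) (hc0 l), by
      rw [← hrow i]
      exact Finset.sum_le_sum fun l _ => mul_le_of_le_one_right (hD i l) (hc1 l)⟩)
    (by
      rw [Finset.sum_comm]
      simp_rw [← Finset.sum_mul, hcol, one_mul, hcsum]) hS hS'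
  -- This is `1 + log u ≤ u` at `u = G l / g i`, weighted by `D i l * c l`.
  have hmain : ∑ i, ∑ l, D i l * c l * (1 + Real.log (G l) - Real.log (g i))
      ≤ ∑ i, (∑ l, D i l * lam l) / g i := by
    refine Finset.sum_le_sum fun i _ => ?_
    rw [Finset.sum_div]
    refine Finset.sum_le_sum fun l _ => ?_
    have h1 := Real.add_one_le_exp (Real.log (G l / g i))
    rw [Real.exp_log (div_pos (hGpos l) (hg i)), Real.log_div (hGpos l).ne' (hg i).ne'] at h1
    calc D i l * c l * (1 + Real.log (G l) - Real.log (g i))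
        ≤ D i l * c l * (G l / g i) :=
          mul_le_mul_of_nonneg_left (by linarith) (mul_nonneg (hD i l) (hc0 l))
      _ = D i l * lam l / g i := by rw [← hcG l]; ring
  have hleft : ∑ i, ∑ l, D i l * c l * (1 + Real.log (G l) - Real.log (g i))
      = t + ∑ l, c l * Real.log (G l) - ∑ i, (∑ l, D i l * c l) * Real.log (g i) := by
    have h1 : ∀ i l, D i l * c l * (1 + Real.log (G l) - Real.log (g i))
        = D i l * (c l + c l * Real.log (G l)) - D i l * c l * Real.log (g i) := by
      intros; ring
    simp_rw [h1, Finset.sum_sub_distrib]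
    congr 1
    · rw [Finset.sum_comm]
      simp_rw [← Finset.sum_mul, hcol, one_mul, Finset.sum_add_distrib, hcsum]
    · simp_rw [Finset.sum_mul]
  have hphi := hsplit Real.log
  linarith

/-! ### Affine majorants of extended-real functions -/

/-- On `C`, the function `F` is the pointwise infimum of its affine majorants. -/
def IsInfAffineOn {E : Type*} [AddCommGroup E] [Module ℝ E] (C : Set E) (F : E → EReal) : Prop :=
  ∀ y ∈ C, ∀ r : ℝ, F y < r → ∃ (L : E →ₗ[ℝ] ℝ) (b : ℝ),
    L y + b < r ∧ ∀ z ∈ C, F z ≤ ((L z + b : ℝ) : EReal)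

namespace IsInfAffineOn

variable {E : Type*} [AddCommGroup E] [Module ℝ E] {C : Set E} {F : E → EReal}

lemma const_add (h : IsInfAffineOn C F) (c : ℝ) : IsInfAffineOn C fun y => (c : EReal) + F y := by
  intro y hy r hr
  have h1 := EReal.add_lt_add_left_coe hr (-c)
  rw [← add_assoc, ← EReal.coe_add, ← EReal.coe_add, neg_add_cancel, EReal.coe_zero,
    zero_add] at h1
  obtain ⟨L, b, hL, hC⟩ := h y hy _ h1
  refine ⟨L, c + b, by linarith, fun z hz => ?_⟩
  calc (c : EReal) + F z ≤ c + ((L z + b : ℝ) : EReal) := by gcongr; exact hC z hz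
    _ = _ := by rw [← EReal.coe_add]; congr 1; ring

/-- If concavity failed at a convex combination, some real `r` would separate the two sides; an
affine majorant below `r` at that point contradicts its own affinity. -/
lemma econcaveOn (h : IsInfAffineOn C F) (hC : Convex ℝ C) (htop : ∀ y ∈ C, F y ≠ ⊤) :
    EConcaveOn C F := by
  refine ⟨hC, htop, fun y hy z hz a b ha hb hab => ?_⟩
  by_contra! hlt
  obtain ⟨r, hr, hr'⟩ := EReal.lt_iff_exists_real_btwn.1 hlt
  obtain ⟨L, c, hL, hF⟩ := h _ (hC hy hz ha hb hab) r hr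
  have h1 : (a : EReal) * F y + (b : EReal) * F z
      ≤ (a : EReal) * ((L y + c : ℝ) : EReal) + (b : EReal) * ((L z + c : ℝ) : EReal) :=
    add_le_add (mul_le_mul_of_nonneg_left (hF y hy) (EReal.coe_nonneg.2 ha))
      (mul_le_mul_of_nonneg_left (hF z hz) (EReal.coe_nonneg.2 hb))
  have h2 := hr'.trans_le h1
  rw [← EReal.coe_mul, ← EReal.coe_mul, ← EReal.coe_add, EReal.coe_lt_coe_iff] at h2
  rw [map_add, map_smul, map_smul, smul_eq_mul, smul_eq_mul] at hL
  have h3 : a * c + b * c = c := by rw [← add_mul, hab, one_mul]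
  linarith

/-- An affine majorant below the level at `y` is continuous in finite dimension, so it keeps `F`
below that level near `y`. -/
lemma upperSemicontinuousOn [TopologicalSpace E] [IsTopologicalAddGroup E] [ContinuousSMul ℝ E]
    [T2Space E] [FiniteDimensional ℝ E] (h : IsInfAffineOn C F) : UpperSemicontinuousOn F C := by
  intro y hy r hr
  obtain ⟨q, hq, hq'⟩ := EReal.lt_iff_exists_real_btwn.1 hr
  obtain ⟨L, b, hL, hF⟩ := h y hy q hq
  have hcont : Continuous fun z => L z + b :=
    L.continuous_of_finiteDimensional.add continuous_const
  filter_upwards [mem_nhdsWithin_of_mem_nhds (hcont.continuousAt.eventually_lt_const hL),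
    self_mem_nhdsWithin] with z hz hzC
  exact (hF z hzC).trans_lt ((EReal.coe_lt_coe_iff.2 hz).trans hq')

end IsInfAffineOn

lemma IsInfAffineOn.comp_linearMap {E E' : Type*} [AddCommGroup E] [Module ℝ E] [AddCommGroup E']
    [Module ℝ E'] {C : Set E} {C' : Set E'} {F : E → EReal} (h : IsInfAffineOn C F)
    (T : E' →ₗ[ℝ] E) (hT : Set.MapsTo T C' C) : IsInfAffineOn C' fun y => F (T y) := by
  intro y hy r hr
  obtain ⟨L, b, hL, hF⟩ := h (T y) (hT hy) r hr
  exact ⟨L.comp T, b, hL, fun z hz => hF _ (hT hz)⟩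

/-! ### The spectral function `Gamma` -/

lemma Gamma_of_isHermitian {k t : ℕ} {X : Matrix (Fin k) (Fin k) ℝ} (hX : X.IsHermitian) :
    Gamma t X = phi t hX.eigenvalues₀ := dif_pos hX

lemma eigenvalues₀_nonneg {k : ℕ} {X : Matrix (Fin k) (Fin k) ℝ} (hX : X.PosSemidef)
    (i : Fin (Fintype.card (Fin k))) : 0 ≤ hX.isHermitian.eigenvalues₀ i := by
  have := hX.eigenvalues_nonneg (Fintype.equivOfCardEq (Fintype.card_fin _) i)
  simpa [IsHermitian.eigenvalues] using this

lemma exists_eq_mul_diagonal_eigenvalues₀ {k : ℕ} {X : Matrix (Fin k) (Fin k) ℝ}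
    (hX : X.IsHermitian) : ∃ Q : Matrix (Fin k) (Fin (Fintype.card (Fin k))) ℝ,
      Q * Qᵀ = 1 ∧ Qᵀ * Q = 1 ∧ X = Q * diagonal hX.eigenvalues₀ * Qᵀ := by
  let e : Fin (Fintype.card (Fin k)) ≃ Fin k := Fintype.equivOfCardEq (Fintype.card_fin _)
  let P : Matrix (Fin k) (Fin k) ℝ := hX.eigenvectorUnitary
  have hP : P * Pᵀ = 1 := by
    have := mem_unitaryGroup_iff.1 hX.eigenvectorUnitary.2
    rwa [star_eq_conjTranspose, conjTranspose_eq_transpose_of_trivial] at this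
  have hQ : P.submatrix id e * (P.submatrix id e)ᵀ = 1 := by
    rw [transpose_submatrix, submatrix_mul_equiv, hP]; simp
  refine ⟨P.submatrix id e, hQ, (mul_eq_one_comm_of_card_eq _ _ _ (by simp)).1 hQ, ?_⟩
  have hdiag : diagonal hX.eigenvalues₀ = (diagonal hX.eigenvalues).submatrix e e := by
    rw [submatrix_diagonal_equiv]
    congr 1
    funext i
    simp [IsHermitian.eigenvalues, e]
  rw [hdiag, transpose_submatrix, submatrix_mul_equiv, submatrix_mul_equiv, submatrix_id_id]
  have := hX.spectral_theorem
  rw [Unitary.conjStarAlgAut_apply, star_eq_conjTranspose,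
    conjTranspose_eq_transpose_of_trivial] at this
  exact this

/-- The affine majorants of `Gamma t`, one for every orthogonal matrix and weight vector. -/
lemma Gamma_le {k t : ℕ} (ht : 0 < t) (htk : t ≤ k) {Y : Matrix (Fin k) (Fin k) ℝ}
    (hY : Y.PosSemidef) {ι : Type*} [Fintype ι] [DecidableEq ι] {Q : Matrix (Fin k) ι ℝ}
    (hQ : Q * Qᵀ = 1) (hQ' : Qᵀ * Q = 1) (S : Finset ι) {g : ι → ℝ} {mu : ℝ} (hmu : 0 < mu)
    (hS : ∀ i ∈ S, mu ≤ g i) (hS' : ∀ i ∉ S, g i = mu) :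
    Gamma t Y ≤ ((∑ i, (Qᵀ * Y * Q) i i / g i
      + (∑ i ∈ S, Real.log (g i) + ((t : ℝ) - S.card) * Real.log mu - t) : ℝ) : EReal) := by
  obtain ⟨P, hP, hP', hYP⟩ := exists_eq_mul_diagonal_eigenvalues₀ hY.isHermitian
  rw [Gamma_of_isHermitian hY.isHermitian]
  set lam := hY.isHermitian.eigenvalues₀
  set R := Qᵀ * P with hR
  have hRt : Rᵀ = Pᵀ * Q := by rw [hR, transpose_mul, transpose_transpose]
  have hRR : R * Rᵀ = 1 := by
    rw [hRt, hR, Matrix.mul_assoc, ← Matrix.mul_assoc P, hP, Matrix.one_mul, hQ']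
  have hRR' : Rᵀ * R = 1 := by
    rw [hRt, hR, Matrix.mul_assoc, ← Matrix.mul_assoc Q, hQ, Matrix.one_mul, hP']
  have hentry : ∀ i, (Qᵀ * Y * Q) i i = ∑ l, R i l ^ 2 * lam l := by
    intro i
    have : Qᵀ * Y * Q = R * diagonal lam * Rᵀ := by
      rw [hRt, hR, hYP]; simp only [Matrix.mul_assoc]
    rw [this, Matrix.mul_apply]
    simp only [mul_diagonal, transpose_apply]
    exact Finset.sum_congr rfl fun l _ => by ring
  simp_rw [hentry]
  refine phi_le_of_doublyStochastic ht (by simpa using htk) hY.isHermitian.eigenvalues₀_antitone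
    (eigenvalues₀_nonneg hY) (fun i l => sq_nonneg _) (fun i => ?_) (fun l => ?_) S hmu hS hS'
  · have := congrFun (congrFun hRR i) i
    simpa [Matrix.mul_apply, sq] using this
  · have := congrFun (congrFun hRR' l) l
    simpa [Matrix.mul_apply, sq] using this

/-- On the positive-semidefinite cone, `Gamma t` is an infimum of affine functions. -/
lemma isInfAffineOn_Gamma {k t : ℕ} (htk : t ≤ k) :
    IsInfAffineOn {X : Matrix (Fin k) (Fin k) ℝ | X.PosSemidef} (Gamma t) := by
  rcases Nat.eq_zero_or_pos t with rfl | ht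
  · intro X hX r hr
    refine ⟨0, 0, ?_, fun Y hY => ?_⟩
    · rw [Gamma_of_isHermitian hX.isHermitian, phi, if_pos rfl] at hr
      simpa using EReal.coe_pos.1 hr
    · rw [Gamma_of_isHermitian hY.isHermitian, phi, if_pos rfl]; simp
  intro X hX r hr
  obtain ⟨Q, hQ, hQ', hXQ⟩ := exists_eq_mul_diagonal_eigenvalues₀ hX.isHermitian
  rw [Gamma_of_isHermitian hX.isHermitian] at hr
  have htk' : t ≤ Fintype.card (Fin k) := by simpa using htk
  set lam := hX.isHermitian.eigenvalues₀
  obtain ⟨j, mu, h⟩ := exists_isSplit ht htk' hX.isHermitian.eigenvalues₀_antitone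
    (eigenvalues₀_nonneg hX)
  have hpos : (0 : ℝ) < (t : ℝ) - j := sub_pos.2 (by exact_mod_cast h.lt)
  set S : Finset (Fin (Fintype.card (Fin k))) := Finset.univ.filter fun i => i.val < j with hSdef
  have hcard : S.card = j := card_filter_val_lt (h.lt.le.trans htk')
  -- It suffices to choose the common weight `nu` of the tail.
  suffices hnu : ∃ nu, 0 < nu ∧ (∀ i ∈ S, nu ≤ lam i) ∧
      j + ((t : ℝ) - j) * mu / nu
        + (∑ i ∈ S, Real.log (lam i) + ((t : ℝ) - j) * Real.log nu - t) < r by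
    obtain ⟨nu, hnu, hle, hlt⟩ := hnu
    let g : Fin (Fintype.card (Fin k)) → ℝ := fun i => if i ∈ S then lam i else nu
    let L : Matrix (Fin k) (Fin k) ℝ →ₗ[ℝ] ℝ :=
      { toFun := fun Y => ∑ i, (Qᵀ * Y * Q) i i / g i
        map_add' := fun Y Z => by
          simp [Matrix.mul_add, Matrix.add_mul, add_div, Finset.sum_add_distrib]
        map_smul' := fun c Y => by simp [mul_div_assoc, Finset.mul_sum] }
    have hgS : ∀ i ∈ S, g i = lam i := fun i hi => if_pos hi
    have hgS' : ∀ i ∉ S, g i = nu := fun i hi => if_neg hi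
    refine ⟨L, ∑ i ∈ S, Real.log (g i) + ((t : ℝ) - S.card) * Real.log nu - t, ?_, fun Y hY => ?_⟩
    · have hLX : L X = j + ((t : ℝ) - j) * mu / nu := by
        have hd : Qᵀ * X * Q = diagonal lam := by
          rw [hXQ, ← Matrix.mul_assoc, ← Matrix.mul_assoc, hQ', Matrix.one_mul, Matrix.mul_assoc,
            hQ', Matrix.mul_one]
        change ∑ i, (Qᵀ * X * Q) i i / g i = _
        rw [hd, ← Finset.sum_filter_add_sum_filter_not Finset.univ
          (fun i : Fin (Fintype.card (Fin k)) => i.val < j)]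
        congr 1
        · have h1 : ∀ i ∈ S, diagonal lam i i / g i = 1 := fun i hi => by
            rw [diagonal_apply_eq, hgS i hi, div_self (hnu.trans_le (hle i hi)).ne']
          rw [Finset.sum_congr rfl h1]
          simp [hcard]
        · have h1 : ∀ i ∈ Finset.univ.filter
              (fun i : Fin (Fintype.card (Fin k)) => ¬ i.val < j),
              diagonal lam i i / g i = lam i / nu := fun i hi => by
            rw [diagonal_apply_eq, hgS' i (by simpa [hSdef] using hi)]
          rw [Finset.sum_congr rfl h1, ← Finset.sum_div, h.sum_tail]
      rw [hLX, hcard, Finset.sum_congr rfl fun i hi => by rw [hgS i hi]]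
      exact hlt
    · exact Gamma_le ht htk hY hQ hQ' S hnu (fun i hi => (hgS i hi).symm ▸ hle i hi) hgS'
  rcases h.nonneg.eq_or_lt with hmu | hmu
  · -- A singular matrix: the tail weight tends to zero.
    subst hmu
    have hlim : Filter.Tendsto (fun nu : ℝ => j + ((t : ℝ) - j) * 0 / nu
        + (∑ i ∈ S, Real.log (lam i) + ((t : ℝ) - j) * Real.log nu - t))
        (nhdsWithin 0 (Set.Ioi 0)) Filter.atBot := by
      simp only [mul_zero, zero_div, add_zero]
      refine Filter.tendsto_atBot_add_const_left _ _
        (Filter.tendsto_atBot_add_const_right _ _ (Filter.tendsto_atBot_add_const_left _ _ ?_))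
      exact Real.tendsto_log_nhdsGT_zero.const_mul_atBot hpos
    have hsmall : ∀ᶠ nu : ℝ in nhdsWithin 0 (Set.Ioi 0), ∀ i ∈ S, nu ≤ lam i := by
      rw [Filter.eventually_all_finset]
      intro i hi
      exact mem_nhdsWithin_of_mem_nhds
        (Iic_mem_nhds (h.head i (by simpa [hSdef] using hi)))
    have hev : ∀ᶠ nu : ℝ in nhdsWithin 0 (Set.Ioi 0), 0 < nu := self_mem_nhdsWithin
    obtain ⟨nu, h1, h2, h3⟩ := (hev.and (hsmall.and (hlim.eventually_lt_atBot r))).exists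
    exact ⟨nu, h1, h2, h3⟩
  -- With `nu = mu`, the trace part is `j + (t - j) = t` and cancels `-t`, so the majorant is tight.
  · rw [h.phi_eq_coe hmu, EReal.coe_lt_coe_iff] at hr
    refine ⟨mu, hmu, fun i hi => (h.head i (by simpa [hSdef] using hi)).le, ?_⟩
    rw [mul_div_cancel_right₀ _ hmu.ne']
    linarith

lemma Gamma_ne_top {k t : ℕ} (htk : t ≤ k) {X : Matrix (Fin k) (Fin k) ℝ} (hX : X.PosSemidef) :
    Gamma t X ≠ ⊤ := by
  rw [Gamma_of_isHermitian hX.isHermitian]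
  rcases Nat.eq_zero_or_pos t with rfl | ht
  · simp [phi]
  obtain ⟨j, mu, h⟩ := exists_isSplit ht (by simpa using htk)
    hX.isHermitian.eigenvalues₀_antitone (eigenvalues₀_nonneg hX)
  rcases h.nonneg.eq_or_lt with hmu | hmu
  · rw [h.phi_eq_bot hmu.symm]; exact bot_ne_top
  · rw [h.phi_eq_coe hmu]; exact EReal.coe_ne_top _

/-- `Gamma t (Mᵀ M)` is the log-determinant of `M Mᵀ` if `M` has `t` rows. -/
lemma Gamma_transpose_mul_self {k : ℕ} {ι : Type*} [Fintype ι] [DecidableEq ι]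
    (hk : Fintype.card ι ≤ k) (M : Matrix ι (Fin k) ℝ) :
    Gamma (Fintype.card ι) (Mᵀ * M) = elog (M * Mᵀ).det := by
  have hX : (Mᵀ * M).PosSemidef := by
    simpa [conjTranspose_eq_transpose_of_trivial] using posSemidef_conjTranspose_mul_self M
  set t := Fintype.card ι with ht
  have hanti := hX.isHermitian.eigenvalues₀_antitone
  have hnn := eigenvalues₀_nonneg hX
  obtain ⟨Q, hQ, hQ', hXQ⟩ := exists_eq_mul_diagonal_eigenvalues₀ hX.isHermitian
  rw [Gamma_of_isHermitian hX.isHermitian]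
  set lam := hX.isHermitian.eigenvalues₀
  have htk : t ≤ Fintype.card (Fin k) := by simpa using hk
  have hchar : (Mᵀ * M).charpoly = ∏ i, (Polynomial.X - Polynomial.C (lam i)) := by
    rw [hX.isHermitian.charpoly_eq]
    refine Fintype.prod_equiv (Fintype.equivOfCardEq (Fintype.card_fin _)).symm _ _ fun i => ?_
    simp [IsHermitian.eigenvalues, lam]
  have hrank : (Mᵀ * M).rank ≤ t := (rank_mul_le_right _ _).trans (rank_le_card_height M)
  have hzero : ∀ i : Fin (Fintype.card (Fin k)), t ≤ i.val → lam i = 0 := by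
    intro i hi
    by_contra hne
    have hpos : 0 < lam i := (hnn i).lt_of_ne' hne
    -- By monotonicity, a nonzero eigenvalue at index `i ≥ t` makes the first `t + 1` eigenvalues
    -- positive.
    have hr : t + 1 ≤ (Mᵀ * M).rank := by
      rw [hX.isHermitian.rank_eq_card_non_zero_eigs, Fintype.card_subtype]
      let e : Fin (Fintype.card (Fin k)) ≃ Fin k := Fintype.equivOfCardEq (Fintype.card_fin _)
      rw [← card_filter_val_lt (k := Fintype.card (Fin k)) (j := t + 1) (by omega)]
      refine Finset.card_le_card_of_injOn e ?_ e.injective.injOn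
      intro l hl
      have hl : l.val < t + 1 := by simpa using hl
      have : 0 < lam l := hpos.trans_le (hanti (by rw [Fin.le_def]; omega))
      have heq : hX.isHermitian.eigenvalues (e l) = lam l := by
        simp [IsHermitian.eigenvalues, e, lam]
      exact Finset.mem_coe.2 (Finset.mem_filter.2 ⟨Finset.mem_univ _, heq ▸ this.ne'⟩)
    omega
  rw [phi_eq_sum_elog htk hanti hnn hzero, ← elog_prod _ _ hnn]
  congr 1
  -- The two characteristic polynomials differ by a power of `X`, which is exactly the factor of the
  -- vanishing eigenvalues. Cancelling it and evaluating at `0` gives the determinant.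
  have hpoly := charpoly_mul_comm_of_le Mᵀ M (by simpa using hk)
  rw [hchar, ← Finset.prod_filter_mul_prod_filter_not Finset.univ
    (fun i : Fin (Fintype.card (Fin k)) => i.val < t), mul_comm] at hpoly
  have hX' : ∏ i with ¬ i.val < t, (Polynomial.X - Polynomial.C (lam i))
      = (Polynomial.X : Polynomial ℝ) ^ (Fintype.card (Fin k) - Fintype.card ι) := by
    rw [Finset.prod_congr rfl (g := fun _ => (Polynomial.X : Polynomial ℝ)) fun i hi => by
      rw [hzero i (by simpa using hi)]; simp]
    rw [Finset.prod_const]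
    congr 1
    have := Finset.card_filter_add_card_filter_not
      (s := (Finset.univ : Finset (Fin (Fintype.card (Fin k))))) (fun i => i.val < t)
    rw [card_filter_val_lt htk, Finset.card_univ,
      Fintype.card_fin (Fintype.card (Fin k))] at this
    omega
  rw [hX'] at hpoly
  have hpoly' := mul_left_cancel₀ (pow_ne_zero _ Polynomial.X_ne_zero) hpoly
  rw [det_eq_sign_charpoly_coeff, ← hpoly', Polynomial.coeff_zero_eq_eval_zero,
    Polynomial.eval_prod]
  simp only [Polynomial.eval_sub, Polynomial.eval_X, Polynomial.eval_C, zero_sub]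
  rw [Finset.prod_neg, card_filter_val_lt htk, ← mul_assoc, ← mul_pow]
  simp

/-! ### The two optimization problems -/

lemma convex_gammaFeasible (n s : ℕ) : Convex ℝ (gammaFeasible n s) := by
  rintro y ⟨hy, hy'⟩ z ⟨hz, hz'⟩ a b ha hb hab
  refine ⟨?_, fun i => ⟨?_, ?_⟩⟩
  · simp only [Pi.add_apply, Pi.smul_apply, smul_eq_mul, Finset.sum_add_distrib,
      ← Finset.mul_sum, hy, hz, ← add_mul, hab, one_mul]
  · simp only [Pi.add_apply, Pi.smul_apply, smul_eq_mul]
    exact add_nonneg (mul_nonneg ha (hy' i).1) (mul_nonneg hb (hz' i).1)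
  · simp only [Pi.add_apply, Pi.smul_apply, smul_eq_mul]
    nlinarith [hy' i, hz' i]

lemma isCompact_gammaFeasible (n s : ℕ) : IsCompact (gammaFeasible n s) := by
  have h : gammaFeasible n s
      = Set.Icc (0 : Fin n → ℝ) 1 ∩ {y | ∑ i, y i = (n : ℝ) - (s : ℝ)} := by
    ext y
    simp only [gammaFeasible, Set.mem_ofPred_eq, Set.mem_inter_iff, Set.mem_Icc, Pi.le_def,
      Pi.zero_apply, Pi.one_apply, forall_and]
    tauto
  rw [h]
  exact isCompact_Icc.inter_right
    (isClosed_eq (continuous_finsetSum _ fun i _ => continuous_apply i) continuous_const)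

lemma gammaFeasible_nonempty {n s : ℕ} (hsn : s ≤ n) : (gammaFeasible n s).Nonempty := by
  refine ⟨fun i => if i.val < n - s then 1 else 0, ?_, fun i => ?_⟩
  · rw [Finset.sum_ite, Finset.sum_const, Finset.sum_const_zero,
      card_filter_val_lt (Nat.sub_le n s), nsmul_eq_mul, Nat.cast_sub hsn]
    ring
  · dsimp only; split_ifs <;> norm_num

lemma one_sub_mem_gammaFeasible {n s : ℕ} {x : Fin n → ℝ} (hx : x ∈ dOptFeasible n s) :
    1 - x ∈ gammaFeasible n s := by
  obtain ⟨hx, hsum⟩ := hx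
  refine ⟨by simp [hsum], fun i => ?_⟩
  rcases hx i with h | h <;> simp [h]

lemma one_sub_mem_dOptFeasible {n s : ℕ} {y : Fin n → ℝ} (hy : y ∈ gammaFeasible n s)
    (hbin : ∀ i, y i = 0 ∨ y i = 1) : 1 - y ∈ dOptFeasible n s := by
  refine ⟨fun i => ?_, by simp [hy.1]⟩
  rcases hbin i with h | h <;> simp [h]

lemma posSemidef_transpose_mul_diagonal_mul {n k : ℕ} (W : Matrix (Fin n) (Fin k) ℝ)
    {y : Fin n → ℝ} (hy : ∀ i, 0 ≤ y i) : (Wᵀ * diagonal y * W).PosSemidef := by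
  simpa [conjTranspose_eq_transpose_of_trivial] using
    (posSemidef_diagonal_iff.2 hy).conjTranspose_mul_mul_same W

lemma isInfAffineOn_gammaObjective {n m k s : ℕ} (hk : n - s ≤ k) (S : Matrix (Fin m) (Fin m) ℝ)
    (W : Matrix (Fin n) (Fin k) ℝ) :
    IsInfAffineOn (gammaFeasible n s) (gammaObjective s S W) := by
  let T : (Fin n → ℝ) →ₗ[ℝ] Matrix (Fin k) (Fin k) ℝ :=
    { toFun := fun y => Wᵀ * diagonal y * W
      map_add' := fun y z => by
        have : diagonal (y + z) = diagonal y + diagonal z := (diagonal_add y z).symm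
        rw [this, Matrix.mul_add, Matrix.add_mul]
      map_smul' := fun c y => by simp [diagonal_smul] }
  exact ((isInfAffineOn_Gamma hk).comp_linearMap T fun y hy =>
    posSemidef_transpose_mul_diagonal_mul W fun i => (hy.2 i).1).const_add _

lemma gammaObjective_ne_top {n m k s : ℕ} (hk : n - s ≤ k) (S : Matrix (Fin m) (Fin m) ℝ)
    (W : Matrix (Fin n) (Fin k) ℝ) {y : Fin n → ℝ} (hy : y ∈ gammaFeasible n s) :
    gammaObjective s S W y ≠ ⊤ :=
  EReal.add_ne_top (EReal.coe_ne_top _)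
    (Gamma_ne_top hk (posSemidef_transpose_mul_diagonal_mul W fun i => (hy.2 i).1))

/-- A 0/1 weight selects rows. Applied to `W`, and in reverse to `U`, in the exactness proof. -/
lemma transpose_mul_diagonal_mul_eq_submatrix {n : ℕ} {κ : Type*} {y : Fin n → ℝ}
    (hy : ∀ i, y i = 0 ∨ y i = 1) (Z : Matrix (Fin n) κ ℝ) :
    Zᵀ * diagonal y * Z = (Z.submatrix (Subtype.val : {i // y i = 1} → Fin n) id)ᵀ
      * Z.submatrix (Subtype.val : {i // y i = 1} → Fin n) id := by
  ext a b
  rw [Matrix.mul_apply, Matrix.mul_apply]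
  simp only [mul_diagonal, transpose_apply, submatrix_apply, id]
  rw [← Finset.sum_subtype (Finset.univ.filter fun i => y i = 1) (by simp)
    fun i => Z i a * Z i b, Finset.sum_filter]
  refine Finset.sum_congr rfl fun i _ => ?_
  rcases hy i with h | h <;> simp [h]

lemma card_support_eq {n s : ℕ} (hsn : s ≤ n) {y : Fin n → ℝ} (hy : ∀ i, y i = 0 ∨ y i = 1)
    (hsum : ∑ i, y i = (n : ℝ) - s) : Fintype.card {i // y i = 1} = n - s := by
  have h : ∀ i, y i = if y i = 1 then 1 else 0 := fun i => by
    rcases hy i with h | h <;> simp [h]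
  rw [Finset.sum_congr rfl fun i _ => h i, Finset.sum_boole, ← Nat.cast_sub hsn] at hsum
  rw [Fintype.card_subtype]
  exact_mod_cast hsum

namespace IsSVD

variable {n m : ℕ} {A U : Matrix (Fin n) (Fin m) ℝ} {S V : Matrix (Fin m) (Fin m) ℝ}

/-- A vanishing singular value would push the rank of `S`, hence that of `A`, below `m`. -/
lemma diagonal_pos (h : IsSVD A U S V) (hA : A.rank = m) (i : Fin m) : 0 < S i i := by
  classical
  refine (h.nonneg i).lt_of_ne' fun hi => ?_
  have h1 : m ≤ S.rank := by
    calc m = (U * S * Vᵀ).rank := by rw [← h.eq, hA]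
      _ ≤ S.rank := (rank_mul_le_left _ _).trans (rank_mul_le_right _ _)
  rw [← h.diag.diagonal_diag, rank_diagonal] at h1
  have h2 := Fintype.card_subtype_lt (p := fun i => S.diag i ≠ 0) (x := i) (by simpa using hi)
  rw [Fintype.card_fin] at h2
  omega

lemma det_eq_prod (h : IsSVD A U S V) : S.det = ∏ i, S i i := by
  conv_lhs => rw [← h.diag.diagonal_diag, det_diagonal]
  rfl

/-- The singular values split off from the objective function of the 0/1 problem. -/
lemma dOptObjective_eq (h : IsSVD A U S V) (hA : A.rank = m) (x : Fin n → ℝ) :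
    dOptObjective A x
      = ((2 * ∑ i, Real.log (S i i) : ℝ) : EReal) + elog (Uᵀ * diagonal x * U).det := by
  have hpos : 0 < S.det := by
    rw [h.det_eq_prod]; exact Finset.prod_pos fun i _ => h.diagonal_pos hA i
  have hV : V.det * V.det = 1 := by
    have := congrArg Matrix.det h.orthV
    rwa [det_mul, det_transpose, det_one] at this
  have hdet : (Aᵀ * diagonal x * A).det
      = S.det ^ 2 * (Uᵀ * diagonal x * U).det := by
    have : Aᵀ * diagonal x * A = V * Sᵀ * (Uᵀ * diagonal x * U) * S * Vᵀ := by
      rw [h.eq]; simp only [transpose_mul, transpose_transpose, Matrix.mul_assoc]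
    rw [this, det_mul, det_mul, det_mul, det_mul, det_transpose, det_transpose]
    linear_combination (S.det ^ 2 * (Uᵀ * diagonal x * U).det) * hV
  rw [dOptObjective, ldet, hdet, elog_mul (sq_nonneg _), elog_of_pos (pow_pos hpos 2),
    Real.log_pow, h.det_eq_prod, Real.log_prod fun i _ => (h.diagonal_pos hA i).ne']
  norm_cast

end IsSVD

lemma gammaObjective_one_sub_eq {n m s : ℕ} (hms : m ≤ s) (hsn : s ≤ n)
    {A U : Matrix (Fin n) (Fin m) ℝ} (hA : A.rank = m) {S V : Matrix (Fin m) (Fin m) ℝ}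
    (hSVD : IsSVD A U S V) {W : Matrix (Fin n) (Fin (n - m)) ℝ}
    (hW : (1 : Matrix (Fin n) (Fin n) ℝ) - U * Uᵀ = W * Wᵀ) {x : Fin n → ℝ}
    (hx : x ∈ dOptFeasible n s) : gammaObjective s S W (1 - x) = dOptObjective A x := by
  classical
  have hbin : ∀ i, (1 - x) i = 0 ∨ (1 - x) i = 1 := fun i => by
    rcases hx.1 i with h | h <;> simp [h]
  have hcard := card_support_eq hsn hbin (one_sub_mem_gammaFeasible hx).1
  rw [hSVD.dOptObjective_eq hA, gammaObjective, transpose_mul_diagonal_mul_eq_submatrix hbin W,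
    ← hcard, Gamma_transpose_mul_self (by omega)]
  congr 2
  set f : {i // (1 - x) i = 1} → Fin n := Subtype.val
  have hWf : W.submatrix f id * (W.submatrix f id)ᵀ
      = 1 - U.submatrix f id * (U.submatrix f id)ᵀ := by
    rw [transpose_submatrix, transpose_submatrix, ← submatrix_mul _ _ _ _ _ Function.bijective_id,
      ← submatrix_mul _ _ _ _ _ Function.bijective_id, ← hW, submatrix_sub,
      ← submatrix_one f Subtype.val_injective]
    rfl
  -- Sylvester's identity passes from order `n - s` to order `m`.
  rw [hWf, det_one_sub_mul_comm, ← transpose_mul_diagonal_mul_eq_submatrix hbin U]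
  have hdiag : diagonal (1 - x) = 1 - diagonal x := by
    rw [← diagonal_one, diagonal_sub]; rfl
  rw [hdiag, Matrix.mul_sub, Matrix.sub_mul, Matrix.mul_one, hSVD.orthU, sub_sub_cancel]

end DOpt

theorem mainTheorem2 (n m s : ℕ) (hms : m ≤ s) (hsn : s ≤ n)
    (A : Matrix (Fin n) (Fin m) ℝ) (hA : A.rank = m)
    (U : Matrix (Fin n) (Fin m) ℝ) (S V : Matrix (Fin m) (Fin m) ℝ)
    (hSVD : DOpt.IsSVD A U S V)
    (W : Matrix (Fin n) (Fin (n - m)) ℝ)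
    (hW : (1 : Matrix (Fin n) (Fin n) ℝ) - U * Matrix.transpose U = W * Matrix.transpose W) :
    -- feasible points correspond, and the objective values agree
    (∀ x ∈ DOpt.dOptFeasible n s,
      1 - x ∈ DOpt.gammaFeasible n s ∧
      DOpt.gammaObjective s S W (1 - x) = DOpt.dOptObjective A x) ∧
    -- the binary feasible points of the relaxation all come from the 0/1 problem
    (∀ y ∈ DOpt.gammaFeasible n s, (∀ i, y i = 0 ∨ y i = 1) →
      1 - y ∈ DOpt.dOptFeasible n s) ∧
    -- the relaxation is a convex optimization problem (a concave maximization problem)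
    DOpt.EConcaveOn (DOpt.gammaFeasible n s) (DOpt.gammaObjective s S W) ∧
    -- its maximum is attained
    (∃ y ∈ DOpt.gammaFeasible n s,
      DOpt.gammaObjective s S W y = DOpt.gammaBound s S W) ∧
    -- and it is an upper bound for the 0/1 problem
    DOpt.dOptValue s A ≤ DOpt.gammaBound s S W := by
  have hk : n - s ≤ n - m := Nat.sub_le_sub_left hms n
  have hinf := DOpt.isInfAffineOn_gammaObjective hk S W
  refine ⟨fun x hx => ⟨DOpt.one_sub_mem_gammaFeasible hx,
      DOpt.gammaObjective_one_sub_eq hms hsn hA hSVD hW hx⟩,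
    fun y hy hbin => DOpt.one_sub_mem_dOptFeasible hy hbin,
    hinf.econcaveOn (DOpt.convex_gammaFeasible n s)
      (fun y hy => DOpt.gammaObjective_ne_top hk S W hy), ?_, ?_⟩
  · obtain ⟨y, hy, hmax⟩ := hinf.upperSemicontinuousOn.exists_isMaxOn
      (DOpt.gammaFeasible_nonempty hsn) (DOpt.isCompact_gammaFeasible n s)
    exact ⟨y, hy, le_antisymm (le_iSup₂ (f := fun y _ => DOpt.gammaObjective s S W y) y hy)
      (iSup₂_le fun z hz => hmax hz)⟩
  · refine iSup₂_le fun x hx => ?_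
    rw [← DOpt.gammaObjective_one_sub_eq hms hsn hA hSVD hW hx]
    exact le_iSup₂ (f := fun y _ => DOpt.gammaObjective s S W y) _
      (DOpt.one_sub_mem_gammaFeasible hx)
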